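/- Let $N$ and $d$ be positive integers such that $d$ divides $N$ and $d<N$. Write $\mathbb{Z}_N$ for the group of integers modulo $N$. Every function $f:\mathbb{Z}_N\to\mathbb{C}$ has a unique Fourier expansion $f(x)=\sum_{k\in\mathbb{Z}_N}\hat f(k)\,e^{2\pi i kx/N}$; its Fourier support is $\operatorname{supp} f=\{k\in\mathbb{Z}_N : \hat f(k)\neq 0\}$, and $f$ is said to have degree at most $d$ if $\operatorname{supp} f\subseteq\{-d,-(d-1),\dots,d-1,d\}$ (modulo $N$). Then there exists a set $\mathcal T\subseteq\mathbb{Z}_N$ with $|\mathcal T|\le 3d\log_2(N/d)$ such that every function $f:\mathbb{Z}_N\to\mathbb{R}_{\ge 0}$ of degree at most $d$ can be written as $f(x)=\sum_{j=1}^{J}|f_j(x)|^2$ for all $x\in\mathbb{Z}_N$, with finitely many functions $f_j:\mathbb{Z}_N\to\mathbb{C}$ satisfying $\operatorname{supp} f_j\subseteq\mathcal T$ for all $j$. -/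

import Mathlib

namespace SparseSOS

/-- The Fourier coefficient `(1 / N) * ∑ x, exp (-2 * π * I * k * x / N) * f x` of a function `f` on
`ℤ / N ℤ` at the frequency `k`, so that `f x = ∑ k, coeff f k * exp (2 * π * I * k * x / N)`. -/
noncomputable def coeff {N : ℕ} [NeZero N] (f : ZMod N → ℂ) (k : ZMod N) : ℂ :=
  (N : ℂ)⁻¹ * ZMod.dft f k

/-- The set of frequencies at which the Fourier coefficient of `f` does not vanish. -/
def fourierSupport {N : ℕ} [NeZero N] (f : ZMod N → ℂ) : Set (ZMod N) :=
  {k | coeff f k ≠ 0}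

/-- `f` has degree at most `d`: its Fourier support lies in `{-d, -(d-1), …, d-1, d}` modulo `N`. -/
def HasDegreeAtMost {N : ℕ} [NeZero N] (d : ℕ) (f : ZMod N → ℂ) : Prop :=
  fourierSupport f ⊆ {k | ∃ j : ℤ, -(d : ℤ) ≤ j ∧ j ≤ d ∧ k = (j : ZMod N)}

/-- `f` is a finite sum of squares of moduli of complex-valued functions on `ℤ / N ℤ`, all of them
with Fourier support in `T`. -/
def HasSOSCertificate {N : ℕ} [NeZero N] (T : Set (ZMod N)) (f : ZMod N → ℝ) : Prop :=
  ∃ (J : ℕ) (g : Fin J → ZMod N → ℂ),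
    (∀ j, fourierSupport (g j) ⊆ T) ∧ ∀ x, f x = ∑ j, ‖g j x‖ ^ 2

end SparseSOS

/-!
For `f ≥ 0` on `ZMod N`, the matrix with entries `coeff f (l - k)` is the Gram matrix of the
vectors `√(f / N) · conj χ_k`, where `χ_k` are the characters (`inner_gramVec`), and `f x` is `1 / N`
times its quadratic form at the vector `(χ_k x)_k` (`norm_sq_sum_gramVec`). If `f` has degree at most
`d`, this matrix is zero off the graph joining residues at cyclic distance at most `d`.

A positive semidefinite matrix whose sparsity pattern lies in a chordal graph is a sum of rank-one
positive semidefinite matrices supported on cliques of that graph; with Gram vectors this is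
Gram-Schmidt orthogonalisation in a perfect elimination order
(`exists_norm_sq_sum_eq_of_elimination`). A square supported on a clique may be multiplied by a
character, so only the cliques up to translation matter for the Fourier support.

With `m = N / d`, cut `ZMod N` into `m` blocks of `d` consecutive residues. The chordal graph is the
blow-up of a triangulation of the `m`-gon with vertices the blocks: blocks are eliminated in the order
of their 2-adic valuation, `0` being last, and the later neighbours of `a = 2 ^ v * (2 * c + 1)` are
`a - 2 ^ v` and `a + 2 ^ v`, the latter replaced by `0` if it reaches `m`. That this order is perfect
is `Linked.trans_of_elimRank_le`. The cliques, translated so that `a` moves to `0`, involve only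
the blocks `0`, `± 2 ^ i` with `i < log₂ m`, and `m % 2 ^ j` with `2 ≤ j ≤ log₂ m`
(`exists_mem_blockShifts`). These are at most `3 log₂ m` blocks of `d` elements each.
-/

namespace SparseSOS

open Finset

/-! ### Gram-Schmidt along a perfect elimination order -/

/-- Gram-Schmidt orthogonalisation along a perfect elimination order: `r` ranks the indices by the
time of their elimination, and the neighbours of `v` in `Γ` which are not eliminated before `v` are
required to be pairwise adjacent. Subtracting from all vectors their components along `a v` then
creates no new nonzero inner product outside `Γ`, so the quadratic form of the Gram matrix is a sum
of squares of linear forms, each involving only an index `v` and its later neighbours. -/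
theorem exists_norm_sq_sum_eq_of_elimination {ι E R : Type*} [Fintype ι] [DecidableEq ι]
    [NormedAddCommGroup E] [InnerProductSpace ℂ E] [LinearOrder R] (Γ : ι → ι → Prop) (r : ι → R)
    (hΓ : ∀ v x y, Γ v x → Γ v y → r v ≤ r x → r v ≤ r y → Γ x y) (S : Finset ι) :
    ∀ a : ι → E, (∀ i, i ∉ S → a i = 0) → (∀ i j, inner ℂ (a i) (a j) ≠ 0 → Γ i j) →
      ∃ w : ι → ι → ℂ, (∀ v i, w v i ≠ 0 → Γ v i ∧ r v ≤ r i) ∧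
        ∀ z : ι → ℂ, ‖∑ i, z i • a i‖ ^ 2 = ∑ v ∈ S, ‖∑ i, z i * w v i‖ ^ 2 := by
  induction hn : #S generalizing S with
  | zero =>
    intro a ha _
    obtain rfl := card_eq_zero.1 hn
    exact ⟨0, by simp, fun z => by simp [ha]⟩
  | succ n ih =>
    intro a ha hsp
    obtain ⟨v, hvS, hmin⟩ := S.exists_min_image r (card_pos.1 (by omega))
    -- `e` is `a v` normalised, or `0` when `a v = 0`.
    obtain ⟨e, he, he0, hev⟩ : ∃ e : E, (e = 0 ∨ ‖e‖ = 1) ∧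
        (∀ u, inner ℂ (a v) u = 0 → inner ℂ e u = 0) ∧ (inner ℂ e (a v) : ℂ) • e = a v := by
      by_cases h : a v = 0
      · exact ⟨0, Or.inl rfl, by simp, by simp [h]⟩
      · have h1 : (‖a v‖ : ℂ) ≠ 0 := by simpa using h
        have h2 : ‖a v‖ ≠ 0 := norm_ne_zero_iff.2 h
        refine ⟨((‖a v‖ : ℂ)⁻¹) • a v, Or.inr (by simp [norm_smul, h2]),
          fun u hu => by rw [inner_smul_left, hu, mul_zero], ?_⟩
        have h3 : (inner ℂ (((‖a v‖ : ℂ)⁻¹) • a v) (a v) : ℂ) = ‖a v‖ := by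
          rw [inner_smul_left, inner_self_eq_norm_sq_to_K]
          simp only [map_inv₀, Complex.conj_ofReal, Complex.coe_algebraMap]
          field_simp
        rw [h3, smul_smul, mul_inv_cancel₀ h1, one_smul]
    have horth : ∀ u, inner ℂ e (u - (inner ℂ e u : ℂ) • e) = 0 := by
      intro u
      rcases he with rfl | he
      · simp
      · simp [inner_self_eq_norm_sq_to_K, he]
    have hpyth : ∀ u, ‖u‖ ^ 2 = ‖(inner ℂ e u : ℂ)‖ ^ 2 + ‖u - (inner ℂ e u : ℂ) • e‖ ^ 2 := by
      intro u
      have h1 : ‖(inner ℂ e u : ℂ) • e‖ = ‖(inner ℂ e u : ℂ)‖ := by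
        rcases he with rfl | he
        · simp
        · rw [norm_smul, he, mul_one]
      have h2 := norm_add_sq_eq_norm_sq_add_norm_sq_of_inner_eq_zero (𝕜 := ℂ)
        ((inner ℂ e u : ℂ) • e) (u - (inner ℂ e u : ℂ) • e)
        (by rw [inner_smul_left, horth, mul_zero])
      rw [add_sub_cancel, h1] at h2
      simpa only [sq] using h2
    have hadj : ∀ i, inner ℂ e (a i) ≠ 0 → Γ v i ∧ r v ≤ r i := by
      intro i hi
      refine ⟨hsp v i fun h => hi (he0 _ h), hmin i ?_⟩
      by_contra h
      exact hi (by simp [ha i h])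
    set b : ι → E := fun i => a i - (inner ℂ e (a i) : ℂ) • e with hb
    have hb0 : ∀ i, i ∉ S.erase v → b i = 0 := by
      intro i hi
      by_cases hiv : i = v
      · rw [hiv, hb]
        exact sub_eq_zero.2 hev.symm
      · have : a i = 0 := ha i fun h => hi (mem_erase.2 ⟨hiv, h⟩)
        simp [hb, this]
    have hbsp : ∀ i j, inner ℂ (b i) (b j) ≠ 0 → Γ i j := by
      intro i j hij
      have key : inner ℂ (b i) (b j)
          = inner ℂ (a i) (a j) - inner ℂ e (a j) * inner ℂ (a i) e := by
        have h1 : inner ℂ (b i) (b j) = inner ℂ (a i) (b j) := by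
          change inner ℂ (a i - _ • e) (b j) = _
          rw [inner_sub_left, inner_smul_left, horth, mul_zero, sub_zero]
        rw [h1]
        change inner ℂ (a i) (a j - _ • e) = _
        rw [inner_sub_right, inner_smul_right]
      by_cases h : inner ℂ (a i) (a j) = 0
      · have h2 : inner ℂ e (a j) * inner ℂ (a i) e ≠ 0 := by
          intro h3
          rw [key, h, h3] at hij
          simp at hij
        have hi : inner ℂ e (a i) ≠ 0 := fun h3 =>
          right_ne_zero_of_mul h2 (inner_eq_zero_symm.1 h3)
        obtain ⟨h4, h5⟩ := hadj i hi
        obtain ⟨h6, h7⟩ := hadj j (left_ne_zero_of_mul h2)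
        exact hΓ v i j h4 h6 h5 h7
      · exact hsp i j h
    obtain ⟨w, hw, hwz⟩ := ih (S.erase v) (by rw [card_erase_of_mem hvS]; omega) b hb0 hbsp
    refine ⟨Function.update w v fun i => inner ℂ e (a i), fun x i hi => ?_, fun z => ?_⟩
    · by_cases hx : x = v
      · subst hx
        rw [Function.update_self] at hi
        exact hadj i hi
      · rw [Function.update_of_ne hx] at hi
        exact hw x i hi
    · have h1 : (inner ℂ e (∑ i, z i • a i) : ℂ) = ∑ i, z i * inner ℂ e (a i) := by
        simp
      have h2 : ∑ i, z i • b i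
          = (∑ i, z i • a i) - (inner ℂ e (∑ i, z i • a i) : ℂ) • e := by
        simp only [hb, h1, smul_sub, sum_sub_distrib, sum_smul, smul_smul]
      rw [hpyth, ← h2, h1, hwz, ← add_sum_erase S _ hvS, Function.update_self]
      congr 1
      refine sum_congr rfl fun x hx => ?_
      rw [Function.update_of_ne (ne_of_mem_erase hx)]

/-! ### A perfect elimination order on the blocks -/

/-- The largest power of two dividing `a` (equal to `1` at the junk argument `a = 0`). -/
def twoPart (a : ℕ) : ℕ := 2 ^ padicValNat 2 a

theorem twoPart_two_pow_mul (v c : ℕ) : twoPart (2 ^ v * (2 * c + 1)) = 2 ^ v := by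
  have : padicValNat 2 (2 * c + 1) = 0 := padicValNat.eq_zero_of_not_dvd (by omega)
  rw [twoPart, padicValNat.mul (by positivity) (by omega), this]
  simp

theorem exists_eq_two_pow_mul {a : ℕ} (ha : 0 < a) : ∃ v c, a = 2 ^ v * (2 * c + 1) := by
  obtain ⟨v, c, ⟨k, hk⟩, h⟩ := Nat.exists_eq_two_pow_mul_odd ha.ne'
  exact ⟨v, k, by rw [h, hk]⟩

/-- The lower of the two later neighbours of a block `a > 0`. -/
def lowerNbr (a : ℕ) : ℕ := a - twoPart a

/-- The upper of the two later neighbours of a block `a > 0` on the cycle of length `m`: it is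
`min (a + twoPart a) m`, with `m` identified with `0`. -/
def upperNbr (m a : ℕ) : ℕ := if a + twoPart a < m then a + twoPart a else 0

/-- `b` is adjacent to `a` and eliminated later; the block `0` is eliminated last. -/
def LaterNbr (m a b : ℕ) : Prop := 0 < a ∧ (b = lowerNbr a ∨ b = upperNbr m a)

/-- The reflexive adjacency relation of a triangulation of the `m`-gon with vertices
`0, …, m - 1`. -/
def Linked (m a b : ℕ) : Prop := a = b ∨ LaterNbr m a b ∨ LaterNbr m b a

/-- The elimination rank of the block `a`: blocks of smaller rank are eliminated first. The value
`m` at `0` exceeds all others, since `twoPart a ≤ a < m` for `0 < a < m`. -/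
def elimRank (m a : ℕ) : ℕ := if a = 0 then m else twoPart a

theorem Linked.symm {m a b : ℕ} (h : Linked m a b) : Linked m b a := by
  rcases h with h | h | h
  · exact Or.inl h.symm
  · exact Or.inr (Or.inr h)
  · exact Or.inr (Or.inl h)

theorem LaterNbr.elimRank_lt {m a b : ℕ} (ham : a < m) (h : LaterNbr m a b) :
    elimRank m a < elimRank m b := by
  obtain ⟨ha, h⟩ := h
  obtain ⟨v, c, rfl⟩ := exists_eq_two_pow_mul ha
  have hp : 0 < 2 ^ v := by positivity
  have h2 : b = 0 ∨ ∃ c', 0 < c' ∧ b = 2 ^ (v + 1) * c' := by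
    rcases h with h | h
    · rw [lowerNbr, twoPart_two_pow_mul] at h
      rcases Nat.eq_zero_or_pos c with rfl | hc
      · left; simpa using h
      · right
        refine ⟨c, hc, ?_⟩
        rw [h, mul_add, pow_succ, mul_one, Nat.add_sub_cancel]; ring
    · rw [upperNbr, twoPart_two_pow_mul] at h
      split_ifs at h with h1
      · right
        exact ⟨c + 1, by omega, by rw [h]; ring⟩
      · left; exact h
  have hle : 2 ^ v ≤ 2 ^ v * (2 * c + 1) := Nat.le_mul_of_pos_right _ (by omega)
  rw [elimRank, if_neg ha.ne', twoPart_two_pow_mul]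
  rcases h2 with rfl | ⟨c', hc', rfl⟩
  · simp only [elimRank, if_true]; omega
  · obtain ⟨u, c'', rfl⟩ := exists_eq_two_pow_mul hc'
    rw [elimRank, if_neg (by positivity), ← mul_assoc, ← pow_add, twoPart_two_pow_mul]
    exact Nat.pow_lt_pow_right (by omega) (by omega)

/-- The two later neighbours of `a` are adjacent. With `a = 2 ^ v * (2 * c + 1)`, they are
`2 ^ (v + 1) * c` and `2 ^ (v + 1) * (c + 1)` (or `0`, when the latter reaches `m`): if `c` is odd,
the upper one is a later neighbour of the lower one, and if `c` is even it is the other way round,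
unless the upper one is `0`, which is then a later neighbour of the lower one for any `c > 0`. -/
theorem linked_lowerNbr_upperNbr {m a : ℕ} (ha : 0 < a) (ham : a < m) :
    Linked m (lowerNbr a) (upperNbr m a) := by
  obtain ⟨v, c, rfl⟩ := exists_eq_two_pow_mul ha
  have hp : 0 < 2 ^ v := by positivity
  have hlow : lowerNbr (2 ^ v * (2 * c + 1)) = 2 ^ (v + 1) * c := by
    rw [lowerNbr, twoPart_two_pow_mul, mul_add, mul_one, Nat.add_sub_cancel]; ring
  have hup : 2 ^ v * (2 * c + 1) + 2 ^ v = 2 ^ (v + 1) * c + 2 ^ (v + 1) := by ring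
  rw [hlow, upperNbr, twoPart_two_pow_mul, hup]
  rcases Nat.even_or_odd' c with ⟨c, rfl | rfl⟩
  · split_ifs with h
    · right; right
      have e : 2 ^ (v + 1) * (2 * c) + 2 ^ (v + 1) = 2 ^ (v + 1) * (2 * c + 1) := by ring
      refine ⟨by omega, Or.inl ?_⟩
      rw [e, lowerNbr, twoPart_two_pow_mul, mul_add, mul_one, Nat.add_sub_cancel]
    · rcases Nat.eq_zero_or_pos c with rfl | hc
      · left; simp
      · right; left
        refine ⟨by positivity, Or.inr ?_⟩
        obtain ⟨u, c', rfl⟩ := exists_eq_two_pow_mul hc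
        have e : 2 ^ (v + 1) * (2 * (2 ^ u * (2 * c' + 1))) = 2 ^ (v + 2 + u) * (2 * c' + 1) := by
          ring
        have hle : 2 ^ (v + 1) ≤ 2 ^ (v + 2 + u) := Nat.pow_le_pow_right (by omega) (by omega)
        rw [e] at h ⊢
        rw [upperNbr, twoPart_two_pow_mul, if_neg (by omega)]
  · right; left
    refine ⟨by positivity, Or.inr ?_⟩
    rw [upperNbr, twoPart_two_pow_mul]

/-- The ordering by `elimRank` is a perfect elimination order of the triangulation. -/
theorem Linked.trans_of_elimRank_le {m a b c : ℕ} (ha : a < m) (hb : b < m) (hc : c < m)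
    (hab : Linked m a b) (hac : Linked m a c) (hrb : elimRank m a ≤ elimRank m b)
    (hrc : elimRank m a ≤ elimRank m c) : Linked m b c := by
  rcases hab with rfl | ⟨h0, hab⟩ | hab
  · exact hac
  · rcases hac with rfl | ⟨-, hac⟩ | hac
    · exact Or.inr (Or.inr ⟨h0, hab⟩)
    · rcases hab with rfl | rfl <;> rcases hac with rfl | rfl
      · exact Or.inl rfl
      · exact linked_lowerNbr_upperNbr h0 ha
      · exact (linked_lowerNbr_upperNbr h0 ha).symm
      · exact Or.inl rfl
    · exact absurd (hac.elimRank_lt hc) (by omega)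
  · exact absurd (hab.elimRank_lt hb) (by omega)

theorem twoPart_of_odd {a : ℕ} (h : a % 2 = 1) : twoPart a = 1 := by
  have := twoPart_two_pow_mul 0 (a / 2)
  rwa [pow_zero, one_mul, show 2 * (a / 2) + 1 = a by omega] at this

theorem linked_succ {m a : ℕ} (ha : a + 1 < m) : Linked m a (a + 1) := by
  rcases Nat.mod_two_eq_zero_or_one a with h | h
  · exact Or.inr (Or.inr ⟨by omega, Or.inl (by
      rw [lowerNbr, twoPart_of_odd (by omega)]; omega)⟩)
  · exact Or.inr (Or.inl ⟨by omega, Or.inr (by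
      rw [upperNbr, twoPart_of_odd h, if_pos ha])⟩)

theorem linked_zero_last (m : ℕ) : Linked m 0 (m - 1) := by
  rcases Nat.lt_or_ge 1 m with h | h
  · have : 0 < twoPart (m - 1) := by unfold twoPart; positivity
    exact Or.inr (Or.inr ⟨by omega, Or.inr (by rw [upperNbr, if_neg (by omega)])⟩)
  · left; omega

/-! ### The set of frequencies -/

/-- Representatives modulo `m` of all differences `b - a`, where `b` is `a` or a later neighbour
of `a`: zero, the powers `± 2 ^ i` coming from the dyadic triangles, and the remainders `m % 2 ^ j`
coming from the triangles with vertex `0` in which `m` cuts off `a + twoPart a`. The exponents `j`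
at most `1` are left out because `m % 2 ^ j` is then `0` or `2 ^ 0`. -/
def blockShifts (m : ℕ) : Finset ℤ :=
  insert 0 ((range (Nat.log 2 m)).image (fun i => (2 : ℤ) ^ i) ∪
    (range (Nat.log 2 m)).image (fun i => -(2 : ℤ) ^ i) ∪
    (Icc 2 (Nat.log 2 m)).image (fun j => ((m % 2 ^ j : ℕ) : ℤ)))

theorem card_blockShifts_le {m : ℕ} (hm : 2 ≤ m) : #(blockShifts m) ≤ 3 * Nat.log 2 m := by
  have hk : 0 < Nat.log 2 m := Nat.log_pos (by omega) hm
  have h1 := card_insert_le (0 : ℤ) ((range (Nat.log 2 m)).image (fun i => (2 : ℤ) ^ i) ∪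
    (range (Nat.log 2 m)).image (fun i => -(2 : ℤ) ^ i) ∪
    (Icc 2 (Nat.log 2 m)).image (fun j => ((m % 2 ^ j : ℕ) : ℤ)))
  have h2 := card_union_le ((range (Nat.log 2 m)).image (fun i => (2 : ℤ) ^ i) ∪
    (range (Nat.log 2 m)).image (fun i => -(2 : ℤ) ^ i))
    ((Icc 2 (Nat.log 2 m)).image (fun j => ((m % 2 ^ j : ℕ) : ℤ)))
  have h3 := card_union_le ((range (Nat.log 2 m)).image (fun i => (2 : ℤ) ^ i))
    ((range (Nat.log 2 m)).image (fun i => -(2 : ℤ) ^ i))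
  have h4 : #((range (Nat.log 2 m)).image (fun i => (2 : ℤ) ^ i)) ≤ _ := card_image_le
  have h5 : #((range (Nat.log 2 m)).image (fun i => -(2 : ℤ) ^ i)) ≤ _ := card_image_le
  have h6 : #((Icc 2 (Nat.log 2 m)).image (fun j => ((m % 2 ^ j : ℕ) : ℤ))) ≤ _ := card_image_le
  rw [card_range] at h4 h5
  rw [Nat.card_Icc] at h6
  unfold blockShifts
  omega

theorem two_pow_mem_blockShifts {m v : ℕ} (h : 2 ^ (v + 1) ≤ m) :
    (2 : ℤ) ^ v ∈ blockShifts m ∧ -(2 : ℤ) ^ v ∈ blockShifts m := by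
  have : v < Nat.log 2 m := Nat.lt_of_succ_le (Nat.le_log_of_pow_le (by omega) h)
  constructor <;> simp only [blockShifts, mem_insert, mem_union, mem_image, mem_range]
  · exact Or.inr (Or.inl (Or.inl ⟨v, this, rfl⟩))
  · exact Or.inr (Or.inl (Or.inr ⟨v, this, rfl⟩))

theorem mod_two_pow_mem_blockShifts {m v : ℕ} (hm : 2 ≤ m) (h : 2 ^ v ≤ m) :
    ((m % 2 ^ v : ℕ) : ℤ) ∈ blockShifts m := by
  have hv : v ≤ Nat.log 2 m := Nat.le_log_of_pow_le (by omega) h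
  by_cases h2 : 2 ≤ v
  · simp only [blockShifts, mem_insert, mem_union, mem_image, mem_Icc]
    exact Or.inr (Or.inr ⟨v, ⟨h2, hv⟩, rfl⟩)
  · have h0 : (0 : ℤ) ∈ blockShifts m := mem_insert_self _ _
    have h1 : (1 : ℤ) ∈ blockShifts m := by
      simpa using (two_pow_mem_blockShifts (m := m) (v := 0) (by simpa using hm)).1
    have : v = 0 ∨ v = 1 := by omega
    rcases this with rfl | rfl
    · simpa [Nat.mod_one] using h0
    · rcases Nat.mod_two_eq_zero_or_one m with h | h
      · simpa [h] using h0
      · simpa [h] using h1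

theorem exists_mem_blockShifts {m a b : ℕ} (hm : 2 ≤ m) (ha : a < m) (hb : b < m)
    (hab : Linked m a b) (hr : elimRank m a ≤ elimRank m b) :
    ∃ u ∈ blockShifts m, (m : ℤ) ∣ (b : ℤ) - a - u := by
  have h0 : (0 : ℤ) ∈ blockShifts m := mem_insert_self _ _
  rcases hab with rfl | ⟨hpos, hab⟩ | hab
  · exact ⟨0, h0, by simp⟩
  · obtain ⟨v, c, rfl⟩ := exists_eq_two_pow_mul hpos
    have hp : 0 < 2 ^ v := by positivity
    have hz : (((2 ^ v : ℕ)) : ℤ) = 2 ^ v := by push_cast; rfl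
    have hle : 2 ^ v ≤ 2 ^ v * (2 * c + 1) := Nat.le_mul_of_pos_right _ (by omega)
    have hs : 2 ^ (v + 1) = 2 * 2 ^ v := by ring
    rcases hab with hab | hab
    · rw [lowerNbr, twoPart_two_pow_mul] at hab
      by_cases h : 2 ^ (v + 1) ≤ m
      · exact ⟨_, (two_pow_mem_blockShifts h).2, by rw [← hz]; exact ⟨0, by omega⟩⟩
      -- Here `a = 2 ^ v` is the largest power of two in range, and `-2 ^ v ≡ m % 2 ^ v` modulo `m`.
      · refine ⟨_, mod_two_pow_mem_blockShifts hm (v := v) (by omega), -1, ?_⟩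
        rw [Nat.mod_eq_sub_mod (by omega), Nat.mod_eq_of_lt (by omega)]
        omega
    · rw [upperNbr, twoPart_two_pow_mul] at hab
      split_ifs at hab with h
      · exact ⟨_, (two_pow_mem_blockShifts (v := v) (by omega)).1,
          by rw [← hz]; exact ⟨0, by omega⟩⟩
      · rcases eq_or_ne (2 ^ v * (2 * c + 1) + 2 ^ v) m with h1 | h1
        · exact ⟨_, (two_pow_mem_blockShifts (v := v) (by omega)).1,
            by rw [← hz]; exact ⟨-1, by omega⟩⟩
        -- Here `a` is the largest multiple of `2 ^ v` below `m`, so `-a ≡ m % 2 ^ v` modulo `m`.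
        · refine ⟨_, mod_two_pow_mem_blockShifts hm (v := v) (by omega), -1, ?_⟩
          have : m % 2 ^ v = m - 2 ^ v * (2 * c + 1) := by
            conv_lhs => rw [show m = (m - 2 ^ v * (2 * c + 1)) + 2 ^ v * (2 * c + 1) by omega]
            rw [Nat.add_mul_mod_self_left, Nat.mod_eq_of_lt (by omega)]
          rw [this]
          omega
  · exact absurd (hab.elimRank_lt hb) (by omega)

/-- Two residues at cyclic distance at most `d` lie in linked blocks. -/
theorem linked_div_of_sub_le {m d x y : ℕ} (hd : 0 < d) (hx : x < d * m) (hyx : y ≤ x)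
    (h : x - y ≤ d ∨ d * m - d ≤ x - y) : Linked m (y / d) (x / d) := by
  have hxm : x / d < m := (Nat.div_lt_iff_lt_mul hd).2 (by rwa [mul_comm])
  rcases h with h | h
  · have h1 : y / d ≤ x / d := Nat.div_le_div_right hyx
    have h2 : x / d ≤ (y + d) / d := Nat.div_le_div_right (by omega)
    rw [Nat.add_div_right _ hd] at h2
    have : x / d = y / d ∨ x / d = y / d + 1 := by omega
    rcases this with h3 | h3
    · exact Or.inl h3.symm
    · rw [h3]; exact linked_succ (by omega)
  · have h1 : y / d = 0 := Nat.div_eq_of_lt (by omega)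
    have h2 : m - 1 ≤ x / d := by
      rw [Nat.le_div_iff_mul_le hd, mul_comm, Nat.mul_sub_one]
      omega
    rw [h1, show x / d = m - 1 by omega]
    exact linked_zero_last m

theorem linked_div_of_sub_eq_intCast {N d : ℕ} [NeZero N] (hd : 0 < d) (hdvd : d ∣ N)
    {k l : ZMod N} {j : ℤ} (hj : -(d : ℤ) ≤ j) (hj' : j ≤ d) (h : k - l = (j : ZMod N)) :
    Linked (N / d) (k.val / d) (l.val / d) := by
  have hN : d * (N / d) = N := Nat.mul_div_cancel' hdvd
  have hk := ZMod.val_lt k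
  have hl := ZMod.val_lt l
  have h1 : (((k.val : ℤ) - l.val - j : ℤ) : ZMod N) = 0 := by
    push_cast
    rw [ZMod.natCast_zmod_val, ZMod.natCast_zmod_val, h, sub_self]
  obtain ⟨q, hq⟩ := (ZMod.intCast_zmod_eq_zero_iff_dvd _ _).1 h1
  have hdN : d ≤ N := Nat.le_of_dvd (by omega) hdvd
  have hq1 : q < 2 := by
    by_contra! hc
    have : (N : ℤ) * 2 ≤ N * q := by gcongr
    omega
  have hq2 : -2 < q := by
    by_contra! hc
    have : (N : ℤ) * q ≤ N * (-2) := by gcongr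
    omega
  have hcases : ∀ x y : ℕ, x < N → y ≤ x → (x - y ≤ d ∨ N - d ≤ x - y) →
      Linked (N / d) (y / d) (x / d) := fun x y hx hy h =>
    linked_div_of_sub_le hd (by omega) hy (by rwa [hN])
  rcases le_total l.val k.val with hle | hle
  · refine (hcases _ _ hk hle ?_).symm
    interval_cases q <;> omega
  · refine hcases _ _ hl hle ?_
    interval_cases q <;> omega

/-! ### The Gram matrix of Fourier coefficients -/

theorem coeff_invDFT {N : ℕ} [NeZero N] (u : ZMod N → ℂ) (k : ZMod N) :
    coeff (ZMod.dft.symm u) k = (N : ℂ)⁻¹ * u k := by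
  simp [coeff]

theorem coeff_smul {N : ℕ} [NeZero N] (c : ℂ) (u : ZMod N → ℂ) (k : ZMod N) :
    coeff (c • u) k = c * coeff u k := by
  simp [coeff]; ring

/-- The vectors whose Gram matrix is the circulant matrix of the Fourier coefficients of `f`, see
`inner_gramVec`: the characters of `ZMod N`, conjugated and weighted by `√(f / N)`. -/
noncomputable def gramVec {N : ℕ} [NeZero N] (f : ZMod N → ℝ) (k : ZMod N) :
    EuclideanSpace ℂ (ZMod N) :=
  WithLp.toLp 2 fun y => (Real.sqrt (f y / N) : ℂ) * ZMod.stdAddChar (-(k * y))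

theorem inner_gramVec {N : ℕ} [NeZero N] {f : ZMod N → ℝ} (hf : ∀ x, 0 ≤ f x) (k l : ZMod N) :
    inner ℂ (gramVec f k) (gramVec f l) = coeff (fun x => (f x : ℂ)) (l - k) := by
  rw [coeff, ZMod.dft_apply, PiLp.inner_apply, mul_sum]
  refine sum_congr rfl fun y _ => ?_
  have h1 : ((Real.sqrt (f y / N) : ℂ)) * (Real.sqrt (f y / N) : ℂ) = (N : ℂ)⁻¹ * f y := by
    rw [← Complex.ofReal_mul, Real.mul_self_sqrt (div_nonneg (hf y) (Nat.cast_nonneg N))]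
    push_cast
    rw [div_eq_inv_mul]
  have h2 : ZMod.stdAddChar (-(l * y)) * (starRingEnd ℂ) (ZMod.stdAddChar (-(k * y)))
      = ZMod.stdAddChar (-(y * (l - k))) := by
    rw [← AddChar.map_neg_eq_conj, ← AddChar.map_add_eq_mul]
    congr 1; ring
  simp only [gramVec, RCLike.inner_apply, map_mul, Complex.conj_ofReal, smul_eq_mul]
  rw [← h2]
  linear_combination ZMod.stdAddChar (-(l * y)) *
    (starRingEnd ℂ) (ZMod.stdAddChar (-(k * y))) * h1

/-- The value `N * f x` of the quadratic form of the Gram matrix at the vector of all the characters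
evaluated at `x`; by orthogonality of characters the combination of vectors is concentrated
at `x`. -/
theorem norm_sq_sum_gramVec {N : ℕ} [NeZero N] {f : ZMod N → ℝ} (hf : ∀ x, 0 ≤ f x)
    (x : ZMod N) : ‖∑ k, (ZMod.stdAddChar (k * x) : ℂ) • gramVec f k‖ ^ 2 = N * f x := by
  have hN : (N : ℝ) ≠ 0 := Nat.cast_ne_zero.2 (NeZero.ne N)
  have h : ∑ k, (ZMod.stdAddChar (k * x) : ℂ) • gramVec f k
      = EuclideanSpace.single x ((N : ℂ) * (Real.sqrt (f x / N) : ℂ)) := by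
    ext y
    have h1 : ∀ k : ZMod N, (ZMod.stdAddChar (k * x) : ℂ) * ZMod.stdAddChar (-(k * y))
        = ZMod.stdAddChar (k * (x - y)) := fun k => by
      rw [← AddChar.map_add_eq_mul]; congr 1; ring
    have h2 := AddChar.sum_mulShift (x - y) (ZMod.isPrimitive_stdAddChar N)
    simp only [gramVec, WithLp.ofLp_sum, WithLp.ofLp_smul, Finset.sum_apply, Pi.smul_apply,
      smul_eq_mul, mul_left_comm _ (Real.sqrt (f y / N) : ℂ), h1, ← mul_sum, h2, sub_eq_zero]
    by_cases hxy : x = y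
    · subst hxy; simp [ZMod.card, mul_comm]
    · simp [hxy, Ne.symm hxy]
  rw [h, PiLp.norm_single, norm_mul, Complex.norm_natCast, Complex.norm_real,
    mul_pow, Real.norm_eq_abs, sq_abs,
    Real.sq_sqrt (div_nonneg (hf x) (Nat.cast_nonneg N))]
  field_simp

/-! ### The certificate -/

/-- The set of frequencies of the certificate: the blocks of `d` consecutive residues starting at
`u * d`, for `u` in `blockShifts (N / d)`. -/
def shiftedBlocks (N d : ℕ) [NeZero N] : Finset (ZMod N) :=
  (blockShifts (N / d) ×ˢ range d).image fun p => ((p.1 * d + p.2 : ℤ) : ZMod N)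

theorem hasSOSCertificate_shiftedBlocks {N d : ℕ} [NeZero N] (hdvd : d ∣ N) (hlt : d < N)
    {f : ZMod N → ℝ} (hf : ∀ x, 0 ≤ f x) (hdeg : HasDegreeAtMost d (fun x => (f x : ℂ))) :
    HasSOSCertificate (shiftedBlocks N d : Set (ZMod N)) f := by
  have hd : 0 < d := Nat.pos_of_dvd_of_pos hdvd (by omega)
  have hN : d * (N / d) = N := Nat.mul_div_cancel' hdvd
  have hm : 2 ≤ N / d := by
    by_contra! h
    have : d * (N / d) ≤ d * 1 := Nat.mul_le_mul_left d (by omega)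
    omega
  have hblk : ∀ k : ZMod N, k.val / d < N / d := fun k =>
    (Nat.div_lt_iff_lt_mul hd).2 (by rw [mul_comm, hN]; exact k.val_lt)
  obtain ⟨w, hw, hwz⟩ := exists_norm_sq_sum_eq_of_elimination
    (fun k l : ZMod N => Linked (N / d) (k.val / d) (l.val / d))
    (fun k => elimRank (N / d) (k.val / d))
    (fun v x y => Linked.trans_of_elimRank_le (hblk v) (hblk x) (hblk y))
    univ (gramVec f) (by simp) (by
      intro k l hkl
      rw [inner_gramVec hf] at hkl
      obtain ⟨j, hj, hj', h⟩ := hdeg hkl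
      exact (linked_div_of_sub_eq_intCast hd hdvd hj hj' h).symm)
  set c : ZMod N → ZMod N := fun v => ((d * (v.val / d) : ℕ) : ZMod N) with hc
  set g : ZMod N → ZMod N → ℂ := fun v =>
    (Real.sqrt N : ℂ) • ZMod.dft.symm (fun k => w v (k + c v)) with hg
  -- Translating the Fourier support of a summand by the start `c v` of the block of `v` multiplies
  -- the summand by a character, which does not change its modulus.
  have hsupp : ∀ v, fourierSupport (g v) ⊆ (shiftedBlocks N d : Set (ZMod N)) := by
    intro v k hk
    have hk' : w v (k + c v) ≠ 0 := by
      intro h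
      apply hk
      rw [hg, coeff_smul, coeff_invDFT, h, mul_zero, mul_zero]
    obtain ⟨h1, h2⟩ := hw v _ hk'
    obtain ⟨u, hu, q, hq⟩ := exists_mem_blockShifts hm (hblk _) (hblk _) h1 h2
    refine mem_coe.2 (mem_image.2 ⟨(u, (k + c v).val % d), ?_, ?_⟩)
    · exact mem_product.2 ⟨hu, mem_range.2 (Nat.mod_lt _ hd)⟩
    · have h3 : ((k + c v).val : ℤ) = d * ((k + c v).val / d : ℕ) + ((k + c v).val % d : ℕ) := by
        exact_mod_cast (Nat.div_add_mod _ _).symm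
      have h4 : u * d + ((k + c v).val % d : ℕ)
          = ((k + c v).val : ℤ) - (d * (v.val / d) : ℕ) - (d * (N / d) : ℕ) * q := by
        rw [h3]
        simp only [Nat.cast_mul]
        linear_combination (-(d : ℤ)) * hq
      change ((u * d + ((k + c v).val % d : ℕ) : ℤ) : ZMod N) = k
      rw [h4, hN, Int.cast_sub, Int.cast_sub, Int.cast_mul]
      simp only [Int.cast_natCast, ZMod.natCast_self, zero_mul, sub_zero, ZMod.natCast_zmod_val]
      exact add_sub_cancel_right k (c v)
  have hval : ∀ v x, ‖g v x‖ ^ 2 = (N : ℝ)⁻¹ * ‖∑ k, ZMod.stdAddChar (k * x) * w v k‖ ^ 2 := by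
    intro v x
    have hN0 : (N : ℝ) ≠ 0 := Nat.cast_ne_zero.2 (NeZero.ne N)
    have h1 : ∑ k, ZMod.stdAddChar (k * x) * w v k
        = ZMod.stdAddChar (c v * x) * ∑ k, ZMod.stdAddChar (k * x) * w v (k + c v) := by
      rw [← Equiv.sum_comp (Equiv.addRight (c v)), mul_sum]
      refine sum_congr rfl fun k _ => ?_
      rw [← mul_assoc, ← AddChar.map_add_eq_mul]
      simp [add_mul, add_comm]
    rw [h1, norm_mul, AddChar.norm_apply, one_mul]
    simp only [hg, Pi.smul_apply, ZMod.invDFT_apply, smul_eq_mul, norm_mul, mul_pow]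
    rw [norm_inv, Complex.norm_natCast, Complex.norm_real, Real.norm_eq_abs, sq_abs,
      Real.sq_sqrt (Nat.cast_nonneg N)]
    field_simp
  refine ⟨Fintype.card (ZMod N), fun j => g ((Fintype.equivFin (ZMod N)).symm j),
    fun j => hsupp _, fun x => ?_⟩
  rw [Equiv.sum_comp (Fintype.equivFin (ZMod N)).symm (fun v => ‖g v x‖ ^ 2)]
  simp only [hval, ← mul_sum, ← hwz]
  rw [norm_sq_sum_gramVec hf, inv_mul_cancel_left₀ (Nat.cast_ne_zero.2 (NeZero.ne N))]

theorem card_shiftedBlocks_le {N d : ℕ} [NeZero N] (hdvd : d ∣ N) (hlt : d < N) :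
    (#(shiftedBlocks N d) : ℝ) ≤ 3 * d * Real.logb 2 (N / d) := by
  have hd : 0 < d := Nat.pos_of_dvd_of_pos hdvd (by omega)
  have hN : d * (N / d) = N := Nat.mul_div_cancel' hdvd
  have hm : 2 ≤ N / d := by
    by_contra! h
    have : d * (N / d) ≤ d * 1 := Nat.mul_le_mul_left d (by omega)
    omega
  have h1 : #(shiftedBlocks N d) ≤ 3 * Nat.log 2 (N / d) * d := by
    refine card_image_le.trans ?_
    rw [card_product, card_range]
    exact Nat.mul_le_mul_right d (card_blockShifts_le hm)
  have h2 : (Nat.log 2 (N / d) : ℝ) ≤ Real.logb 2 (N / d) := by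
    rw [← Nat.cast_div hdvd (by positivity)]
    exact_mod_cast Real.natLog_le_logb (N / d) 2
  calc (#(shiftedBlocks N d) : ℝ) ≤ 3 * Nat.log 2 (N / d) * d := by exact_mod_cast h1
    _ = 3 * d * Nat.log 2 (N / d) := by ring
    _ ≤ _ := by gcongr

end SparseSOS

theorem theorem3 (N d : ℕ) [NeZero N] (hdvd : d ∣ N) (hlt : d < N) :
    ∃ T : Finset (ZMod N),
      (T.card : ℝ) ≤ 3 * (d : ℝ) * Real.logb 2 ((N : ℝ) / (d : ℝ)) ∧
      ∀ f : ZMod N → ℝ, (∀ x, 0 ≤ f x) →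
        SparseSOS.HasDegreeAtMost d (fun x => (f x : ℂ)) →
        SparseSOS.HasSOSCertificate (T : Set (ZMod N)) f :=
  ⟨SparseSOS.shiftedBlocks N d, SparseSOS.card_shiftedBlocks_le hdvd hlt,
    fun _ hf hdeg => SparseSOS.hasSOSCertificate_shiftedBlocks hdvd hlt hf hdeg⟩
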